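/- Call a real matrix positive (nonnegative) if all its entries are positive (nonnegative). A list $\Lambda=\{\lambda_1,\dots,\lambda_n\}$ of complex numbers is realizable if it is the spectrum, counted with algebraic multiplicity, of a nonnegative $n\times n$ matrix. A Jordan canonical form allowed by $\Lambda$ is a block diagonal matrix $J$ of Jordan blocks whose diagonal entries are, up to order, $\lambda_1,\dots,\lambda_n$, and whose blocks are compatible with $J$ being the Jordan canonical form of a real matrix: for every $z\in\mathbb{C}$ and every $s\ge 1$, $J$ has as many $s\times s$ blocks with eigenvalue $z$ as with eigenvalue $\bar z$. The list $\Lambda$ is universally realizable if it is realizable and for each Jordan canonical form $J$ allowed by $\Lambda$ there is a nonnegative matrix with spectrum $\Lambda$ and Jordan canonical form $J$. **Theorem (Minc).** Let $\Lambda=\{\lambda_1,\dots,\lambda_n\}$ be the spectrum of a positive matrix $A\in\mathbb{R}^{n\times n}$ that is diagonalizable over $\mathbb{C}$. Then $\Lambda$ is universally realizable. Moreover, for each Jordan canonical form $J$ allowed by $\Lambda$ there is a positive matrix with spectrum $\Lambda$ and Jordan canonical form $J$. -/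

import Mathlib

/-- A real matrix is (entrywise) nonnegative. -/
def IsNonnegMatrix {n : ℕ} (A : Matrix (Fin n) (Fin n) ℝ) : Prop :=
  ∀ i j, 0 ≤ A i j

/-- A real matrix is (entrywise) positive. -/
def IsPositiveMatrix {n : ℕ} (A : Matrix (Fin n) (Fin n) ℝ) : Prop :=
  ∀ i j, 0 < A i j

/-- A real matrix regarded as a complex matrix. -/
noncomputable def complexify {n : ℕ} (A : Matrix (Fin n) (Fin n) ℝ) : Matrix (Fin n) (Fin n) ℂ :=
  A.map (algebraMap ℝ ℂ)

/-- The real matrix `A` has spectrum `Λ = {λ₁, …, λₙ}`: its complex eigenvalues, counted with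
algebraic multiplicity, are the entries of the list `Λ` (in some order). -/
def HasSpectrum {n : ℕ} (A : Matrix (Fin n) (Fin n) ℝ) (Λ : Fin n → ℂ) : Prop :=
  (complexify A).charpoly.roots = (Finset.univ : Finset (Fin n)).val.map Λ

/-- Similarity of two complex square matrices whose rows and columns may be labelled by different
index types: `A = P B P⁻¹` for an invertible `P`, with inverse `Q`. -/
def IsSimilarMatrix {m n : Type} [Fintype m] [Fintype n] [DecidableEq m] [DecidableEq n]
    (A : Matrix m m ℂ) (B : Matrix n n ℂ) : Prop :=
  ∃ (P : Matrix m n ℂ) (Q : Matrix n m ℂ), P * Q = 1 ∧ Q * P = 1 ∧ A = P * B * Q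

/-- A real matrix is diagonalizable (over the complex numbers). -/
def IsDiagonalizableMatrix {n : ℕ} (A : Matrix (Fin n) (Fin n) ℝ) : Prop :=
  ∃ d : Fin n → ℂ, IsSimilarMatrix (complexify A) (Matrix.diagonal d)

/-- The `s × s` Jordan block with eigenvalue `z`: `z` on the diagonal, `1` on the superdiagonal. -/
noncomputable def jordanBlock (z : ℂ) (s : ℕ) : Matrix (Fin s) (Fin s) ℂ :=
  Matrix.of fun i j => if i = j then z else if (i : ℕ) + 1 = (j : ℕ) then 1 else 0

/-- The data of a Jordan canonical form: a finite list of Jordan blocks, each given by its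
eigenvalue and its positive size. -/
structure JordanForm where
  /-- the number of blocks -/
  numBlocks : ℕ
  /-- the eigenvalue of each block -/
  eig : Fin numBlocks → ℂ
  /-- the size of each block -/
  size : Fin numBlocks → ℕ
  size_pos : ∀ b, 0 < size b

namespace JordanForm

/-- The block diagonal matrix with the given Jordan blocks. -/
noncomputable def toMatrix (J : JordanForm) :
    Matrix (Σ b : Fin J.numBlocks, Fin (J.size b)) (Σ b : Fin J.numBlocks, Fin (J.size b)) ℂ :=
  Matrix.blockDiagonal' fun b => jordanBlock (J.eig b) (J.size b)

/-- The multiset of diagonal entries: the eigenvalue of each block, repeated as often as the size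
of the block. -/
noncomputable def eigenvalues (J : JordanForm) : Multiset ℂ :=
  ∑ b, Multiset.replicate (J.size b) (J.eig b)

/-- The multiset of blocks, as pairs (eigenvalue, size). -/
noncomputable def blocks (J : JordanForm) : Multiset (ℂ × ℕ) :=
  (Finset.univ : Finset (Fin J.numBlocks)).val.map fun b => (J.eig b, J.size b)

/-- `J` is a possible Jordan canonical form allowed by the list `Λ`: its eigenvalues are those
of `Λ` with multiplicity and, as the form is to be that of a real matrix, its non-real blocks
occur in conjugate pairs, that is, for all `z` and `s` there are as many `s × s` blocks with
eigenvalue `z` as with the conjugate of `z`. -/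
def AllowedBy (J : JordanForm) {n : ℕ} (Λ : Fin n → ℂ) : Prop :=
  J.eigenvalues = (Finset.univ : Finset (Fin n)).val.map Λ ∧
    J.blocks.map (fun p => (starRingEnd ℂ p.1, p.2)) = J.blocks

end JordanForm

/-- The real matrix `M` has Jordan canonical form `J`. -/
def HasJordanForm {n : ℕ} (M : Matrix (Fin n) (Fin n) ℝ) (J : JordanForm) : Prop :=
  IsSimilarMatrix (complexify M) J.toMatrix

/-- `Λ` is realizable: it is the spectrum of a nonnegative matrix. -/
def IsRealizable {n : ℕ} (Λ : Fin n → ℂ) : Prop :=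
  ∃ M : Matrix (Fin n) (Fin n) ℝ, IsNonnegMatrix M ∧ HasSpectrum M Λ

/-- `Λ` is universally realizable: it is realizable and, for each possible Jordan canonical form
allowed by `Λ`, there is a nonnegative matrix with spectrum `Λ` and that Jordan canonical form.
(For a `Λ` that is closed under conjugation the diagonal form is allowed, so that the first clause
follows from the second; it only keeps other lists from being universally realizable for want of
an allowed form.) -/
def IsUniversallyRealizable {n : ℕ} (Λ : Fin n → ℂ) : Prop :=
  IsRealizable Λ ∧ ∀ J : JordanForm, J.AllowedBy Λ →
    ∃ M : Matrix (Fin n) (Fin n) ℝ, IsNonnegMatrix M ∧ HasSpectrum M Λ ∧ HasJordanForm M J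

/-! Write `A = P D Q` with `Q = P⁻¹` and `D` the diagonal of `J`, and let `N` be the nilpotent part
of `J`. For `ε ≠ 0` the matrix `A + ε P N Q` is similar to `D + ε N`, hence to `J`
(`isSimilarMatrix_diagonal_add_smul`), and for small `ε > 0` it is still positive, provided that `P
N Q` is real.

Reality is the crux. Since `J` is allowed, an involution `σ` pairs its blocks with their conjugates
and fixes `N` (`AllowedBy.exists_involutive`). As `A` is real, its eigenbasis can be chosen so that
conjugation permutes it by `σ` (`exists_conj_compatible_eigenbasis`), and then `P N Q` equals its
own conjugate (`map_star_mul_mul_eq`). -/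

/-! ### Matching families by their values. -/

/-- Two families with the same multiset of values differ by a bijection of the index types. -/
theorem exists_equiv_of_map_univ_eq {α β γ : Type*} [Fintype α] [Fintype β] (f : α → γ) (g : β → γ)
    (h : (Finset.univ : Finset α).val.map f = (Finset.univ : Finset β).val.map g) :
    ∃ e : α ≃ β, ∀ a, g (e a) = f a := by
  classical
  have hc : ∀ c, Nonempty ({a // f a = c} ≃ {b // g b = c}) := by
    intro c
    have := congrArg (Multiset.count c) h
    rw [Multiset.count_map, Multiset.count_map] at this
    refine ⟨Fintype.equivOfCardEq ?_⟩
    rw [Fintype.card_subtype, Fintype.card_subtype]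
    simpa [Finset.card_def, Finset.filter_val, eq_comm] using this
  have e := fun c => (hc c).some
  refine ⟨(Equiv.sigmaFiberEquiv f).symm.trans
    ((Equiv.sigmaCongrRight e).trans (Equiv.sigmaFiberEquiv g)), fun a => ?_⟩
  exact (e (f a) ⟨a, rfl⟩).2

/-- A family whose multiset of values is invariant under an involution `c` of the values carries
an involution of its index type that induces `c` on the values. -/
theorem exists_involutive_of_map_eq {β γ : Type*} [Fintype β] (f : β → γ) (c : γ → γ)
    (hc : Function.Involutive c)
    (h : ((Finset.univ : Finset β).val.map f).map c = (Finset.univ : Finset β).val.map f) :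
    ∃ τ : β → β, Function.Involutive τ ∧ ∀ b, f (τ b) = c (f b) := by
  classical
  set N : γ → ℕ := fun x => ((Finset.univ : Finset β).val.map f).count x with hN
  have hNc : ∀ x, N (c x) = N x := by
    intro x
    conv_lhs => rw [hN, ← h]
    exact Multiset.count_map_eq_count' c _ hc.injective x
  have hcard : ∀ x, Nonempty ({b // f b = x} ≃ Fin (N x)) := by
    intro x
    refine ⟨Fintype.equivFinOfCardEq ?_⟩
    rw [Fintype.card_subtype]
    simp [hN, Multiset.count_map, Finset.card_def, Finset.filter_val, eq_comm]
  have e := fun x => (hcard x).some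
  have inv : ∀ x y (hxy : N x = N y) (hyx : N y = N x) (b : {b // f b = y}) (b' : {b // f b = x}),
      b.1 = ((e y).symm (Fin.cast hxy (e x b'))).1 →
      (e x).symm (Fin.cast hyx (e y b)) = b' := by
    intro x y hxy hyx b b' hb
    rw [Subtype.ext hb]
    simp
  -- Each fibre of `f` is numbered; `b` goes to the element with the same number in the fibre over
  -- `c (f b)`.
  refine ⟨fun b => (e (c (f b))).symm (Fin.cast (hNc (f b)).symm (e (f b) ⟨b, rfl⟩)), ?_,
    fun b => ((e (c (f b))).symm _).2⟩
  intro b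
  -- The numbering depends on the value of `f`, so that value and its image under `c` become
  -- variables to be substituted.
  have gen : ∀ (b₂ : β) (y : γ) (hy : f b₂ = y) (x : γ) (hx : c y = x) (h' : N y = N x),
      (((e (c (f b₂))).symm (Fin.cast (hNc (f b₂)).symm (e (f b₂) ⟨b₂, rfl⟩))).1 : β) =
        ((e x).symm (Fin.cast h' (e y ⟨b₂, hy⟩))).1 := by
    intro b₂ y hy x hx h'
    subst hy hx
    rfl
  refine (gen _ (c (f b)) ((e (c (f b))).symm _).2 (f b) (hc _) (hNc _)).trans ?_
  exact congrArg Subtype.val (inv (f b) (c (f b)) (hNc _).symm (hNc _) _ ⟨b, rfl⟩ rfl)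

/-! ### Similarity, characteristic polynomials and Jordan forms. -/

/-- Similar matrices have the same number of rows. -/
theorem IsSimilarMatrix.card_eq {m n : Type} [Fintype m] [Fintype n] [DecidableEq m]
    [DecidableEq n] {A : Matrix m m ℂ} {B : Matrix n n ℂ} (h : IsSimilarMatrix A B) :
    Fintype.card m = Fintype.card n := by
  obtain ⟨P, Q, hPQ, hQP, -⟩ := h
  have h₁ := congrArg Matrix.trace hPQ
  rw [Matrix.trace_mul_comm, hQP, Matrix.trace_one, Matrix.trace_one] at h₁
  exact_mod_cast h₁.symm

/-- Similar matrices have the same characteristic polynomial. -/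
theorem IsSimilarMatrix.charpoly_eq {m n : Type} [Fintype m] [Fintype n] [DecidableEq m]
    [DecidableEq n] {A : Matrix m m ℂ} {B : Matrix n n ℂ} (h : IsSimilarMatrix A B) :
    A.charpoly = B.charpoly := by
  have hc := h.card_eq
  obtain ⟨P, Q, hPQ, hQP, rfl⟩ := h
  rw [Matrix.charpoly_mul_comm_of_le _ _ hc.ge, ← Matrix.mul_assoc, hQP, Matrix.one_mul, hc]
  simp

theorem Matrix.roots_charpoly_diagonal {m : Type} [Fintype m] [DecidableEq m] (d : m → ℂ) :
    (Matrix.diagonal d).charpoly.roots = (Finset.univ : Finset m).val.map d := by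
  rw [Matrix.charpoly_diagonal]
  rw [← Polynomial.roots_multiset_prod_X_sub_C ((Finset.univ : Finset m).val.map d),
    Multiset.map_map]
  rfl

namespace JordanForm

theorem eigenvalues_eq_map (J : JordanForm) :
    J.eigenvalues = (Finset.univ : Finset (Σ b : Fin J.numBlocks, Fin (J.size b))).val.map
      fun k => J.eig k.1 := by
  rw [← Multiset.sum_map_singleton (Multiset.map _ _), Multiset.map_map]
  change _ = ∑ k : (Σ b : Fin J.numBlocks, Fin (J.size b)), ({J.eig k.1} : Multiset ℂ)
  rw [Fintype.sum_sigma]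
  simp [eigenvalues, Multiset.nsmul_singleton]

/-- The nilpotent part of a Jordan form: ones on the superdiagonals of the blocks. -/
noncomputable def nilpotentPart (J : JordanForm) :
    Matrix (Σ b : Fin J.numBlocks, Fin (J.size b)) (Σ b : Fin J.numBlocks, Fin (J.size b)) ℂ :=
  Matrix.of fun k l => if k.1 = l.1 ∧ (k.2 : ℕ) + 1 = (l.2 : ℕ) then 1 else 0

theorem toMatrix_eq (J : JordanForm) :
    J.toMatrix = Matrix.diagonal (fun k => J.eig k.1) + J.nilpotentPart := by
  ext ⟨b, i⟩ ⟨b', j⟩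
  by_cases hb : b = b'
  · subst hb
    rw [toMatrix, Matrix.blockDiagonal'_apply_eq]
    by_cases hij : i = j
    · subst hij
      simp [jordanBlock, nilpotentPart]
    · simp [jordanBlock, nilpotentPart, hij]
  · rw [toMatrix, Matrix.blockDiagonal'_apply_ne _ _ _ hb]
    simp [nilpotentPart, hb]

/-- In the lexicographic order on (block, position) the matrix is upper triangular, so only its
diagonal matters. -/
theorem roots_charpoly_toMatrix (J : JordanForm) : J.toMatrix.charpoly.roots = J.eigenvalues := by
  let lex : LinearOrder (Σ b : Fin J.numBlocks, Fin (J.size b)) :=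
    inferInstanceAs (LinearOrder (Σₗ b : Fin J.numBlocks, Fin (J.size b)))
  have htri : @Matrix.IsUpperTriangular _ ℂ _ lex.toLT J.toMatrix := by
    rintro k l hkl
    have hne : k ≠ l := (@ne_of_lt _ lex.toPreorder _ _ hkl).symm
    rw [toMatrix_eq, Matrix.add_apply, Matrix.diagonal_apply_ne _ hne, zero_add]
    refine if_neg ?_
    rintro ⟨h₁, h₂⟩
    obtain ⟨b, i⟩ := k
    obtain ⟨b', j⟩ := l
    obtain rfl : b = b' := h₁
    have hlex : Sigma.Lex (· < ·) (fun _ => (· < ·))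
        (⟨b, j⟩ : Σ b : Fin J.numBlocks, Fin (J.size b)) ⟨b, i⟩ := hkl
    rcases Sigma.lex_iff.1 hlex with h | ⟨_, h⟩
    · exact lt_irrefl _ h
    · have h₃ : (j : ℕ) < i := h
      simp only at h₂
      omega
  have hdet : J.toMatrix.charpoly = (Matrix.diagonal fun k :
      (Σ b : Fin J.numBlocks, Fin (J.size b)) => J.eig k.1).charpoly := by
    rw [@Matrix.charpoly_of_isUpperTriangular ℂ _ _ _ _ lex _ htri, Matrix.charpoly_diagonal]
    simp [toMatrix_eq, nilpotentPart]
  rw [hdet, Matrix.roots_charpoly_diagonal, eigenvalues_eq_map]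

/-- Scaling the nilpotent part by a nonzero factor does not change the similarity class. -/
theorem isSimilarMatrix_diagonal_add_smul (J : JordanForm) {ε : ℂ} (hε : ε ≠ 0) :
    IsSimilarMatrix (Matrix.diagonal (fun k => J.eig k.1) + ε • J.nilpotentPart) J.toMatrix := by
  -- This conjugation multiplies an entry at positions `i`, `j` of a block by `ε ^ (j - i)`: by `1`
  -- on the diagonal, by `ε` on the superdiagonal.
  refine ⟨Matrix.diagonal fun k => ε⁻¹ ^ (k.2 : ℕ), Matrix.diagonal fun k => ε ^ (k.2 : ℕ),
    ?_, ?_, ?_⟩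
  · simp [Matrix.diagonal_mul_diagonal, hε]
  · simp [Matrix.diagonal_mul_diagonal, hε]
  · rw [toMatrix_eq]
    ext k l
    rw [Matrix.mul_diagonal, Matrix.diagonal_mul]
    by_cases hkl : k = l
    · subst hkl
      simp [nilpotentPart]
      field_simp
    · by_cases h : k.1 = l.1 ∧ (k.2 : ℕ) + 1 = (l.2 : ℕ)
      · have hN : J.nilpotentPart k l = 1 := if_pos h
        rw [Matrix.add_apply, Matrix.add_apply, Matrix.smul_apply, hN,
          Matrix.diagonal_apply_ne _ hkl, ← h.2, pow_succ]
        simp only [zero_add, smul_eq_mul, mul_one, inv_pow]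
        field_simp
      · simp [nilpotentPart, hkl, h]

/-- The blocks of an allowed Jordan form can be matched with their conjugates, and this gives an
involution of the index type. -/
theorem AllowedBy.exists_involutive {J : JordanForm} {n : ℕ} {Λ : Fin n → ℂ}
    (h : J.AllowedBy Λ) :
    ∃ σ : (Σ b : Fin J.numBlocks, Fin (J.size b)) ≃ (Σ b : Fin J.numBlocks, Fin (J.size b)),
      Function.Involutive σ ∧ (∀ k, J.eig (σ k).1 = starRingEnd ℂ (J.eig k.1)) ∧
        J.nilpotentPart.submatrix σ σ = J.nilpotentPart := by
  obtain ⟨τ, hτ, hτf⟩ := exists_involutive_of_map_eq (fun b => (J.eig b, J.size b))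
    (fun p => (starRingEnd ℂ p.1, p.2)) (fun p => by simp) h.2
  have he : ∀ b, J.eig (τ b) = starRingEnd ℂ (J.eig b) := fun b => congrArg Prod.fst (hτf b)
  have hs : ∀ b, J.size (τ b) = J.size b := fun b => congrArg Prod.snd (hτf b)
  -- The involution moves whole blocks and keeps the position inside the block, so superdiagonals go
  -- to superdiagonals.
  have hσ : Function.Involutive
      (fun k : (Σ b : Fin J.numBlocks, Fin (J.size b)) =>
        (⟨τ k.1, Fin.cast (hs k.1).symm k.2⟩ : Σ b : Fin J.numBlocks, Fin (J.size b))) := by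
    rintro ⟨b, i⟩
    refine Sigma.ext (hτ b) ?_
    refine (Fin.heq_ext_iff (by simp [hs])).2 ?_
    simp
  refine ⟨hσ.toPerm, hσ, fun k => he k.1, ?_⟩
  ext k l
  simp [nilpotentPart, hτ.injective.eq_iff]

end JordanForm

/-! ### Eigenbases compatible with complex conjugation. -/

/-- For every square matrix `U` some `c • 1 + conj c • U` is invertible. -/
theorem exists_isUnit_smul_one_add_conj_smul {m : Type*} [Fintype m] [DecidableEq m]
    (U : Matrix m m ℂ) :
    ∃ c : ℂ, IsUnit (c • (1 : Matrix m m ℂ) + starRingEnd ℂ c • U) := by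
  have hne : ∀ t : ℝ, (t : ℂ) - Complex.I ≠ 0 := by
    intro t ht
    simpa using congrArg Complex.im ht
  -- For `c = t + i` the matrix is singular only if `-c / conj c` is an eigenvalue of `U`. These
  -- quotients are distinct for distinct real `t`, and `U` has finitely many eigenvalues.
  have hinj : Function.Injective
      fun t : ℝ => -(((t : ℂ) + Complex.I) / ((t : ℂ) - Complex.I)) := by
    intro s t hst
    have h₁ := neg_injective hst
    rw [div_eq_div_iff (hne s) (hne t)] at h₁
    have h₂ : 2 * Complex.I * ((t : ℂ) - s) = 0 := by linear_combination h₁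
    simpa [sub_eq_zero, eq_comm] using h₂
  obtain ⟨_, ⟨t, rfl⟩, ht⟩ :=
    (Set.infinite_range_of_injective hinj).exists_notMem_finset U.charpoly.roots.toFinset
  refine ⟨(t : ℂ) + Complex.I, ?_⟩
  rw [Multiset.mem_toFinset, Polynomial.mem_roots U.charpoly_monic.ne_zero,
    Polynomial.IsRoot.def, Matrix.eval_charpoly] at ht
  rw [Matrix.isUnit_iff_isUnit_det, isUnit_iff_ne_zero]
  have hEq : ((t : ℂ) + Complex.I) • (1 : Matrix m m ℂ) +
      starRingEnd ℂ ((t : ℂ) + Complex.I) • U =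
      (-((t : ℂ) - Complex.I)) •
        (Matrix.scalar m (-(((t : ℂ) + Complex.I) / ((t : ℂ) - Complex.I))) - U) := by
    ext i j
    by_cases hij : i = j
    · subst hij
      simp
      field_simp [hne t]
      ring
    · simp [hij]
      ring
  rw [hEq, Matrix.det_smul]
  exact mul_ne_zero (pow_ne_zero _ (neg_ne_zero.2 (hne t))) ht

/-- A matrix with real entries that is similar to a diagonal matrix whose diagonal is mapped to its
conjugate by an involution `σ` has an eigenbasis in which conjugation acts through `σ`. -/
theorem exists_conj_compatible_eigenbasis {m k : Type} [Fintype m] [DecidableEq m] [Fintype k]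
    [DecidableEq k] (A : Matrix m m ℂ) (hA : A.map (starRingEnd ℂ) = A) (d : k → ℂ)
    (h : IsSimilarMatrix A (Matrix.diagonal d)) (σ : k ≃ k) (hσ : Function.Involutive σ)
    (hd : ∀ i, d (σ i) = starRingEnd ℂ (d i)) :
    ∃ (P : Matrix m k ℂ) (Q : Matrix k m ℂ), P * Q = 1 ∧ Q * P = 1 ∧
      A = P * Matrix.diagonal d * Q ∧ P.map (starRingEnd ℂ) = P.submatrix id σ := by
  obtain ⟨P₀, Q₀, hPQ, hQP, hAP⟩ := h
  have hAP₀ : A * P₀ = P₀ * Matrix.diagonal d := by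
    rw [hAP, Matrix.mul_assoc, hQP, Matrix.mul_one]
  -- Conjugating an eigenvector of the real matrix `A` conjugates its eigenvalue; permuting by `σ`
  -- restores the order of the eigenvalues.
  set P₁ : Matrix m k ℂ := (P₀.map (starRingEnd ℂ)).submatrix id σ with hP₁
  have hAP₁ : A * P₁ = P₁ * Matrix.diagonal d := by
    have h₁ := congrArg (fun M => (M.map (starRingEnd ℂ)).submatrix id σ) hAP₀
    simp only [Matrix.map_mul, hA] at h₁
    ext i j
    have h₂ := congrFun (congrFun h₁ i) j
    rw [Matrix.mul_diagonal]
    simp only [Matrix.submatrix_apply, id] at h₂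
    rw [Matrix.diagonal_map (map_zero _), Matrix.mul_diagonal] at h₂
    simpa [Matrix.mul_apply, hP₁, hd] using h₂
  obtain ⟨c, hc⟩ := exists_isUnit_smul_one_add_conj_smul (Q₀ * P₁)
  set S := c • (1 : Matrix k k ℂ) + starRingEnd ℂ c • (Q₀ * P₁) with hS
  have hdet := (Matrix.isUnit_iff_isUnit_det S).1 hc
  -- Conjugation followed by `σ` on the columns swaps the two summands, so it fixes this new basis.
  have hP : P₀ * S = c • P₀ + starRingEnd ℂ c • P₁ := by
    rw [hS, Matrix.mul_add, Matrix.mul_smul, Matrix.mul_smul, ← Matrix.mul_assoc, hPQ,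
      Matrix.mul_one, Matrix.one_mul]
  have hPQ' : P₀ * S * (S⁻¹ * Q₀) = 1 := by
    rw [Matrix.mul_assoc, ← Matrix.mul_assoc S, Matrix.mul_nonsing_inv _ hdet, Matrix.one_mul, hPQ]
  refine ⟨P₀ * S, S⁻¹ * Q₀, hPQ', ?_, ?_, ?_⟩
  · rw [Matrix.mul_assoc, ← Matrix.mul_assoc Q₀, hQP, Matrix.one_mul, Matrix.nonsing_inv_mul _ hdet]
  · have : A * (P₀ * S) = P₀ * S * Matrix.diagonal d := by
      rw [hP, Matrix.mul_add, Matrix.add_mul, Matrix.mul_smul, Matrix.mul_smul, hAP₀, hAP₁,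
        Matrix.smul_mul, Matrix.smul_mul]
    rw [← this, Matrix.mul_assoc, hPQ', Matrix.mul_one]
  · rw [hP]
    ext i j
    simp [hP₁, hσ j, add_comm]

/-- Conjugation acts on the columns of `P` by `σ`, hence on the rows of its inverse `Q` by `σ`; in
the product the relabellings cancel. -/
theorem map_star_mul_mul_eq {m k : Type} [Fintype m] [DecidableEq m] [Fintype k] [DecidableEq k]
    {P : Matrix m k ℂ} {Q : Matrix k m ℂ} (hPQ : P * Q = 1) (hQP : Q * P = 1) (σ : k ≃ k)
    (hP : P.map (starRingEnd ℂ) = P.submatrix id σ) {N : Matrix k k ℂ}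
    (hN : N.map (starRingEnd ℂ) = N.submatrix σ σ) :
    (P * N * Q).map (starRingEnd ℂ) = P * N * Q := by
  have hQ : Q.map (starRingEnd ℂ) = Q.submatrix σ id := by
    have h₁ : Q.map (starRingEnd ℂ) * P.submatrix id σ = 1 := by
      rw [← hP, ← Matrix.map_mul, hQP, Matrix.map_one _ (map_zero _) (map_one _)]
    have h₂ : P.submatrix id σ * Q.submatrix σ id = 1 := by
      rw [Matrix.submatrix_mul_equiv, hPQ, Matrix.submatrix_id_id]
    calc Q.map (starRingEnd ℂ) = Q.map (starRingEnd ℂ) * (P.submatrix id σ * Q.submatrix σ id) := by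
          rw [h₂, Matrix.mul_one]
      _ = Q.submatrix σ id := by rw [← Matrix.mul_assoc, h₁, Matrix.one_mul]
  rw [Matrix.map_mul, Matrix.map_mul, hP, hQ, hN, Matrix.submatrix_mul_equiv,
    Matrix.submatrix_mul_equiv, Matrix.submatrix_id_id]

/-! ### The positive perturbation. -/

/-- Small perturbations of a positive matrix are positive. -/
theorem IsPositiveMatrix.exists_add_smul {n : ℕ} {A : Matrix (Fin n) (Fin n) ℝ}
    (hA : IsPositiveMatrix A) (E : Matrix (Fin n) (Fin n) ℝ) :
    ∃ ε : ℝ, 0 < ε ∧ IsPositiveMatrix (A + ε • E) := by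
  have h : ∀ᶠ ε : ℝ in nhdsWithin 0 (Set.Ioi 0), ∀ i j, 0 < (A + ε • E) i j := by
    rw [Filter.eventually_all]
    intro i
    rw [Filter.eventually_all]
    intro j
    have hc : Continuous fun ε : ℝ => (A + ε • E) i j := by
      simp only [Matrix.add_apply, Matrix.smul_apply, smul_eq_mul]
      fun_prop
    refine (hc.tendsto 0).mono_left nhdsWithin_le_nhds |>.eventually_const_lt ?_
    simpa using hA i j
  obtain ⟨ε, hε, hpos⟩ := (h.and self_mem_nhdsWithin).exists
  exact ⟨ε, hpos, hε⟩

theorem exists_positive_hasJordanForm {n : ℕ} {Λ : Fin n → ℂ} {A : Matrix (Fin n) (Fin n) ℝ}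
    (hpos : IsPositiveMatrix A) (hdiag : IsDiagonalizableMatrix A) (hspec : HasSpectrum A Λ)
    {J : JordanForm} (hJ : J.AllowedBy Λ) :
    ∃ M : Matrix (Fin n) (Fin n) ℝ, IsPositiveMatrix M ∧ HasSpectrum M Λ ∧ HasJordanForm M J := by
  obtain ⟨d, hd⟩ := hdiag
  have hdΛ : (Finset.univ : Finset (Fin n)).val.map d = J.eigenvalues := by
    rw [hJ.1, ← hspec, hd.charpoly_eq, Matrix.roots_charpoly_diagonal]
  rw [J.eigenvalues_eq_map] at hdΛ
  -- The eigenbasis is reindexed by the positions in the blocks of `J`.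
  obtain ⟨e, he⟩ := exists_equiv_of_map_univ_eq _ _ hdΛ.symm
  have hsim : IsSimilarMatrix (complexify A) (Matrix.diagonal fun k :
      (Σ b : Fin J.numBlocks, Fin (J.size b)) => J.eig k.1) := by
    obtain ⟨P, Q, hPQ, hQP, hA⟩ := hd
    refine ⟨P.submatrix id e, Q.submatrix e id, ?_, ?_, ?_⟩
    · rw [Matrix.submatrix_mul_equiv, hPQ, Matrix.submatrix_id_id]
    · rw [← Matrix.submatrix_mul _ _ e id e Function.bijective_id, hQP]
      simp
    · have : Matrix.diagonal (fun k : (Σ b : Fin J.numBlocks, Fin (J.size b)) => J.eig k.1) =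
          (Matrix.diagonal d).submatrix e e := by
        rw [Matrix.submatrix_diagonal_equiv]
        exact congrArg Matrix.diagonal (funext fun k => (he k).symm)
      rw [this, Matrix.submatrix_mul_equiv, Matrix.submatrix_mul_equiv, Matrix.submatrix_id_id, hA]
  obtain ⟨σ, hσ, hσd, hσN⟩ := hJ.exists_involutive
  obtain ⟨P, Q, hPQ, hQP, hA, hP⟩ := exists_conj_compatible_eigenbasis (complexify A)
    (by ext; simp [complexify]) _ hsim σ hσ hσd
  -- The nilpotent part has entries `0` and `1`, so conjugation and `σ` both fix it.
  have hreal := map_star_mul_mul_eq hPQ hQP σ hP (N := J.nilpotentPart) (by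
    rw [hσN]
    ext
    simp [JordanForm.nilpotentPart, apply_ite (starRingEnd ℂ)])
  set E : Matrix (Fin n) (Fin n) ℝ := (P * J.nilpotentPart * Q).map Complex.re with hE
  have hEc : complexify E = P * J.nilpotentPart * Q := by
    ext i j
    exact Complex.conj_eq_iff_re.1 (congrFun (congrFun hreal i) j)
  obtain ⟨ε, hε, hM⟩ := hpos.exists_add_smul E
  have hMc : complexify (A + ε • E) = complexify A + (ε : ℂ) • complexify E := by
    ext
    simp [complexify]
  have hjf : HasJordanForm (A + ε • E) J := by
    obtain ⟨S, T, hST, hTS, h⟩ :=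
      J.isSimilarMatrix_diagonal_add_smul (Complex.ofReal_ne_zero.2 hε.ne')
    refine ⟨P * S, T * Q, ?_, ?_, ?_⟩
    · rw [Matrix.mul_assoc, ← Matrix.mul_assoc S, hST, Matrix.one_mul, hPQ]
    · rw [Matrix.mul_assoc, ← Matrix.mul_assoc Q, hQP, Matrix.one_mul, hTS]
    · calc complexify (A + ε • E) =
          P * (Matrix.diagonal (fun k => J.eig k.1) + (ε : ℂ) • J.nilpotentPart) * Q := by
            rw [hMc, hEc, Matrix.mul_add, Matrix.add_mul, ← hA, Matrix.mul_smul, Matrix.smul_mul]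
        _ = P * S * J.toMatrix * (T * Q) := by
            rw [h]
            simp only [Matrix.mul_assoc]
  refine ⟨A + ε • E, hM, ?_, hjf⟩
  rw [HasSpectrum, IsSimilarMatrix.charpoly_eq hjf, J.roots_charpoly_toMatrix, hJ.1]

theorem mainTheorem12 (n : ℕ) (Λ : Fin n → ℂ) (A : Matrix (Fin n) (Fin n) ℝ)
    (hpos : IsPositiveMatrix A) (hdiag : IsDiagonalizableMatrix A) (hspec : HasSpectrum A Λ) :
    IsUniversallyRealizable Λ ∧
      ∀ J : JordanForm, J.AllowedBy Λ →
        ∃ M : Matrix (Fin n) (Fin n) ℝ,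
          IsPositiveMatrix M ∧ HasSpectrum M Λ ∧ HasJordanForm M J := by
  refine ⟨⟨⟨A, fun i j => (hpos i j).le, hspec⟩, fun J hJ => ?_⟩,
    fun J hJ => exists_positive_hasJordanForm hpos hdiag hspec hJ⟩
  obtain ⟨M, hM, h⟩ := exists_positive_hasJordanForm hpos hdiag hspec hJ
  exact ⟨M, fun i j => (hM i j).le, h⟩
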